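/- A hypergraph $H=(V,E)$ on a finite vertex set $V$ has as hyperedges a set $E$ of subsets of $V$. An edge $e$ crosses the cut $(S,\bar S)$, $S\subseteq V$, if $e\cap S\neq\emptyset$ and $e\cap\bar S\neq\emptyset$, and $\delta_H(S)$ is the set of edges of $H$ crossing it. A $(1\pm\varepsilon)$-approximate cut sparsifier of $H$ is a hypergraph $H'=(V,E')$ with $E'\subseteq E$ and weights $w':E'\to\mathbb{R}_{\ge 0}$ such that $\bigl|w'(\delta_{H'}(S))-|\delta_H(S)|\bigr|\le\varepsilon\,|\delta_H(S)|$ for all $S\subseteq V$. A query to the oracle $O_{\rm edge}$ consists of a cut $(S,\bar S)$; the answer is an edge drawn uniformly at random from $\delta_H(S)$, independently of the earlier draws (and NIL if $\delta_H(S)=\emptyset$). **Theorem 2.** Let $0<\varepsilon<1$ be fixed. There is no polynomial time randomized algorithm that uses $O_{\rm edge}$ queries alone and constructs a $(1\pm\varepsilon)$-approximate cut sparsifier of an underlying hypergraph with probability better than $o(1)$. In fact polynomially many queries do not suffice, whatever the time spent between them: for every polynomial $p$ there is a function $\delta(n)$ with $\delta(n)\to0$ as $n\to\infty$ such that for every $n$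 and every randomized, adaptive algorithm that makes at most $p(n)$ queries to $O_{\rm edge}$ on hypergraphs with vertex set $\{1,\dots,n\}$ (in particular, every such algorithm with running time at most $p(n)$), there is a hypergraph $H$ on this vertex set for which the algorithm outputs a $(1\pm\varepsilon)$-approximate cut sparsifier of $H$ with probability at most $\delta(n)$. -/

import Mathlib

open Filter Topology
open scoped NNReal ENNReal

/-- A weighted hypergraph `(V, E, w)` on the vertex set `V`: a finite set of hyperedges, each of
them a set of vertices, with nonnegative real weights (only the values of `weight` on hyperedges
in `edges` matter). -/
structure WHypergraph (V : Type) where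
  edges : Finset (Finset V)
  weight : Finset V → ℝ≥0

section Hypergraphs

variable {V : Type} [Fintype V] [DecidableEq V]

/-- The edge `e` crosses the cut `(S, Sᶜ)`: it meets both sides. -/
def Crosses (e S : Finset V) : Prop :=
  (e ∩ S).Nonempty ∧ (e ∩ Sᶜ).Nonempty

instance (e S : Finset V) : Decidable (Crosses e S) :=
  inferInstanceAs (Decidable (_ ∧ _))

/-- `δ_E(S)`: the set of edges in `E` crossing the cut `(S, Sᶜ)`. -/
def cutEdges (E : Finset (Finset V)) (S : Finset V) : Finset (Finset V) :=
  E.filter fun e => Crosses e S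

/-- `w(δ_H(S))`: the weight of the cut `(S, Sᶜ)` in the weighted hypergraph `H`. -/
def WHypergraph.cutWeight (H : WHypergraph V) (S : Finset V) : ℝ :=
  ∑ e ∈ cutEdges H.edges S, (H.weight e : ℝ)

/-- An unweighted hypergraph on `V` is given by its finite set `E` of hyperedges; it is regarded
as the weighted hypergraph in which all weights are `1`. -/
def unweighted (E : Finset (Finset V)) : WHypergraph V where
  edges := E
  weight := fun _ => 1

/-- `H'` is a `(1 ± ε)`-approximate cut sparsifier of `H`: its hyperedges are hyperedges of `H`,
and the weight of every cut is preserved up to a factor `1 ± ε`. -/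
def IsCutSparsifier (ε : ℝ) (H' H : WHypergraph V) : Prop :=
  H'.edges ⊆ H.edges ∧
    ∀ S : Finset V, |H'.cutWeight S - H.cutWeight S| ≤ ε * H.cutWeight S

/-- The cut edge oracle `O_edge` of the unweighted hypergraph `E`: on the query `(S, Sᶜ)` it
returns a uniformly random edge crossing the cut, and `none` if no edge crosses it. -/
noncomputable def edgeOracle (E : Finset (Finset V)) (S : Finset V) :
    PMF (Option (Finset V)) :=
  if h : (cutEdges E S).Nonempty then (PMF.uniformOfFinset (cutEdges E S) h).map some
  else PMF.pure none

end Hypergraphs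

/-- Randomized adaptive algorithms which access a hypergraph on the vertex set `V` through cut
edge queries only, and which output a weighted hypergraph on `V`. Such an algorithm stops with an
output, or makes a random choice, or queries the oracle at a cut; it goes on depending on the
outcome of the choice or on the answer to the query. Everything else which the algorithm computes
is free of charge. -/
inductive EdgeQueryAlg (V : Type) : Type where
  | output (H' : WHypergraph V) : EdgeQueryAlg V
  | random (μ : PMF ℕ) (next : ℕ → EdgeQueryAlg V) : EdgeQueryAlg V
  | query (S : Finset V) (next : Option (Finset V) → EdgeQueryAlg V) : EdgeQueryAlg V

namespace EdgeQueryAlg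

variable {V : Type} [Fintype V] [DecidableEq V]

/-- The distribution of the output of an algorithm run on the hypergraph `E`; the answers of the
oracle and the random choices of the algorithm are all drawn afresh. -/
noncomputable def run (E : Finset (Finset V)) : EdgeQueryAlg V → PMF (WHypergraph V)
  | output H' => PMF.pure H'
  | random μ next => μ.bind fun r => run E (next r)
  | query S next => (edgeOracle E S).bind fun a => run E (next a)

/-- On the hypergraph `E`, the algorithm makes at most `q` oracle queries, whatever the outcomes
(of positive probability) of the random choices and the answers are. -/
def QueriesAtMost (E : Finset (Finset V)) : EdgeQueryAlg V → ℕ → Prop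
  | output _, _ => True
  | random μ next, q => ∀ r ∈ μ.support, QueriesAtMost E (next r) q
  | query _ _, 0 => False
  | query S next, q + 1 => ∀ a ∈ (edgeOracle E S).support, QueriesAtMost E (next a) q

/-- The probability that the algorithm, run on the unweighted hypergraph `E`, outputs a
`(1 ± ε)`-approximate cut sparsifier of `E`. -/
noncomputable def successProb (ε : ℝ) (E : Finset (Finset V)) (A : EdgeQueryAlg V) : ℝ≥0∞ :=
  (A.run E).toOuterMeasure {H' | IsCutSparsifier ε H' (unweighted E)}

end EdgeQueryAlg

/-!
An algorithm that sees only uniformly random crossing edges cannot tell how many edges a cut has,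
so it cannot weight its output correctly.

Let `E` be a random family of hyperedges, containing each of the `2 ^ n` vertex sets independently
with probability `1 / N`. Every nontrivial cut is crossed by at least `2 ^ (n - 2)` vertex sets, so
as long as `N` is small compared with `2 ^ n` the answers to `q` queries are distributed almost as
on the complete hypergraph of all vertex sets. Indeed, a sequence of answers with the set `F` of
edges, to queries whose cuts have sizes `X j` in `E`, has probability `𝔼 [1_{F ⊆ E} ∏ 1 / X j]`;
since `F` has at most `q` elements, conditioning on `F ⊆ E` hardly changes the means of the `X j`,
and by convexity of `x ↦ -log x` this is at least `1 - q ^ 2 N / 2 ^ (n - 2)` times the probability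
of the same sequence on the complete hypergraph (`le_sum_prod_inv_card`,
`le_sum_likelihood_mul_run`). Neither concentration of all cut sizes nor distinctness of the
answers is needed. Such a lower bound for every event gives an upper bound for every event, by
taking complements (`sum_run_toOuterMeasure_le`).

Now let `N = C ^ i` with `i < k`. Fix one cut. Its size in `E` is concentrated around its mean
(`card_filter_deviation_le`), so a sparsifier must give it a weight in a window around this mean.
For a large constant `C` the `k` windows are disjoint (`sum_weightWindow_le_one`), so on the
complete hypergraph the algorithm hits one of them with probability at most `1 / k`. For the
corresponding density the success probability is at most `1 / k` plus an error of order
`q ^ 2 C ^ k / 2 ^ n`, and `k = Nat.log C n` makes both terms tend to `0`.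
-/

/-! ### Random subfamilies of the complete hypergraph -/

section Counting

variable {V : Type} [Fintype V]

/-- The family of hyperedges selected by a labelling `f` of all vertex sets with `N` labels: those
with label `0`. For a uniformly random `f` every vertex set is selected with probability `1 / N`,
independently of the others. -/
def selected {N : ℕ} [NeZero N] (f : Finset V → Fin N) : Finset (Finset V) :=
  Finset.univ.filter fun e => f e = 0

lemma mem_selected {N : ℕ} [NeZero N] {f : Finset V → Fin N} {e : Finset V} :
    e ∈ selected f ↔ f e = 0 := by simp [selected]

variable [DecidableEq V]

/-- The number of all vertex sets which cross the cut `(S, Sᶜ)`. -/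
def fullCut (S : Finset V) : ℕ := (cutEdges Finset.univ S).card

lemma mem_cutEdges {E : Finset (Finset V)} {S e : Finset V} :
    e ∈ cutEdges E S ↔ e ∈ E ∧ Crosses e S := Finset.mem_filter

lemma two_pow_le_fullCut {S : Finset V} (h : (cutEdges Finset.univ S).Nonempty) :
    2 ^ (Fintype.card V - 2) ≤ fullCut S := by
  obtain ⟨e, he⟩ := h
  obtain ⟨⟨a, ha⟩, ⟨b, hb⟩⟩ := (mem_cutEdges.1 he).2
  have haS : a ∈ S := (Finset.mem_inter.1 ha).2
  have hbS : b ∉ S := by simpa using (Finset.mem_inter.1 hb).2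
  have hab : a ≠ b := by rintro rfl; exact hbS haS
  -- Every vertex set that contains both `a` and `b` crosses the cut.
  have hsub : Finset.Icc {a, b} Finset.univ ⊆ cutEdges Finset.univ S := by
    intro x hx
    have hx' : {a, b} ⊆ x := (Finset.mem_Icc.1 hx).1
    refine mem_cutEdges.2 ⟨Finset.mem_univ _, ⟨a, ?_⟩, ⟨b, ?_⟩⟩
    · exact Finset.mem_inter.2 ⟨hx' (by simp), haS⟩
    · exact Finset.mem_inter.2 ⟨hx' (by simp), by simpa using hbS⟩
  have := Finset.card_le_card hsub
  rwa [Finset.card_Icc_finset (Finset.subset_univ _), Finset.card_pair hab,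
    Finset.card_univ] at this

lemma sum_indicator_subset_selected {N : ℕ} [NeZero N] (F : Finset (Finset V)) :
    ∑ f : Finset V → Fin N, (if F ⊆ selected f then (1 : ℝ) else 0) =
      (Fintype.card (Finset V → Fin N) : ℝ) / (N : ℝ) ^ F.card := by
  have hN : (N : ℝ) ≠ 0 := Nat.cast_ne_zero.2 (NeZero.ne N)
  have hset : (Finset.univ.filter fun f : Finset V → Fin N => F ⊆ selected f) =
      Fintype.piFinset fun e => if e ∈ F then {0} else Finset.univ := by
    ext f
    simp only [Finset.mem_filter, Finset.mem_univ, true_and, Fintype.mem_piFinset]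
    refine forall_congr' fun e => ?_
    by_cases he : e ∈ F <;> simp [he, mem_selected]
  rw [Finset.sum_boole, hset, Fintype.card_piFinset, eq_div_iff (pow_ne_zero _ hN)]
  have h1 : ∀ e : Finset V, (if e ∈ F then ({0} : Finset (Fin N)) else Finset.univ).card *
      (if e ∈ F then N else 1) = N := by
    intro e
    by_cases he : e ∈ F <;> simp [he]
  have h2 : ∏ e : Finset V, (if e ∈ F then N else 1) = N ^ F.card := by
    rw [Finset.prod_ite_mem, Finset.univ_inter, Finset.prod_const]
  rw [← Nat.cast_pow, ← Nat.cast_mul, ← h2, ← Finset.prod_mul_distrib]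
  simp [h1]

lemma card_cutEdges_selected {N : ℕ} [NeZero N] (f : Finset V → Fin N) (S : Finset V) :
    ((cutEdges (selected f) S).card : ℝ) =
      ∑ e ∈ cutEdges Finset.univ S, if e ∈ selected f then (1 : ℝ) else 0 := by
  rw [Finset.sum_boole]
  congr 2
  ext e
  simp [cutEdges, and_comm]

/-- Conditioning on the selection of the edges in `F` increases the expected number of selected
edges in a cut by at most `F.card`. -/
lemma sum_card_cutEdges_le {N : ℕ} [NeZero N] (F : Finset (Finset V)) (S : Finset V) :
    ∑ f : Finset V → Fin N,
        (if F ⊆ selected f then ((cutEdges (selected f) S).card : ℝ) else 0) ≤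
      (Fintype.card (Finset V → Fin N) : ℝ) / (N : ℝ) ^ F.card *
        ((fullCut S : ℝ) / N + F.card) := by
  have hN : (0 : ℝ) < N := Nat.cast_pos.2 (NeZero.pos N)
  set c : ℝ := (Fintype.card (Finset V → Fin N) : ℝ)
  have hc : 0 ≤ c := Nat.cast_nonneg _
  have h1 : ∑ f : Finset V → Fin N,
        (if F ⊆ selected f then ((cutEdges (selected f) S).card : ℝ) else 0) =
      ∑ e ∈ cutEdges Finset.univ S, c / (N : ℝ) ^ (insert e F).card := by
    simp_rw [c, ← sum_indicator_subset_selected]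
    rw [Finset.sum_comm]
    refine Finset.sum_congr rfl fun f _ => ?_
    rw [card_cutEdges_selected]
    by_cases hF : F ⊆ selected f <;> simp [hF, Finset.insert_subset_iff]
  have h2 : ∀ e : Finset V, c / (N : ℝ) ^ (insert e F).card ≤
      c / (N : ℝ) ^ F.card * (1 / N + if e ∈ F then 1 else 0) := by
    intro e
    have hp : 0 ≤ c / (N : ℝ) ^ F.card := by positivity
    by_cases he : e ∈ F
    · rw [Finset.insert_eq_of_mem he, if_pos he]
      have : 0 ≤ 1 / (N : ℝ) := by positivity
      nlinarith
    · rw [Finset.card_insert_of_notMem he, if_neg he, pow_succ, add_zero]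
      apply le_of_eq
      field_simp
  rw [h1]
  refine (Finset.sum_le_sum fun e _ => h2 e).trans ?_
  rw [← Finset.mul_sum, Finset.sum_add_distrib, Finset.sum_const, Finset.sum_boole, nsmul_eq_mul,
    mul_one_div]
  gcongr
  · exact le_rfl
  · intro e he
    exact (Finset.mem_filter.1 he).2

lemma sum_card_cutEdges {N : ℕ} [NeZero N] (S : Finset V) :
    ∑ f : Finset V → Fin N, ((cutEdges (selected f) S).card : ℝ) =
      (Fintype.card (Finset V → Fin N) : ℝ) * ((fullCut S : ℝ) / N) := by
  have h := fun e : Finset V => sum_indicator_subset_selected (N := N) {e}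
  simp only [Finset.singleton_subset_iff, Finset.card_singleton, pow_one] at h
  simp_rw [card_cutEdges_selected]
  rw [Finset.sum_comm]
  simp_rw [h]
  rw [Finset.sum_const, nsmul_eq_mul, fullCut]
  ring

/-- The variance of the number of selected edges in a cut is at most its mean. -/
lemma sum_card_cutEdges_sub_sq_le {N : ℕ} [NeZero N] (S : Finset V) :
    ∑ f : Finset V → Fin N, (((cutEdges (selected f) S).card : ℝ) - (fullCut S : ℝ) / N) ^ 2 ≤
      (Fintype.card (Finset V → Fin N) : ℝ) * ((fullCut S : ℝ) / N) := by
  have hN : (0 : ℝ) < N := Nat.cast_pos.2 (NeZero.pos N)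
  set c : ℝ := (Fintype.card (Finset V → Fin N) : ℝ)
  set m : ℝ := (fullCut S : ℝ) / N
  have h1 : ∑ f : Finset V → Fin N, ((cutEdges (selected f) S).card : ℝ) ^ 2 ≤
      c * (m * (m + 1)) := by
    have : ∑ f : Finset V → Fin N, ((cutEdges (selected f) S).card : ℝ) ^ 2 =
        ∑ e ∈ cutEdges Finset.univ S, ∑ f : Finset V → Fin N,
          (if {e} ⊆ selected f then ((cutEdges (selected f) S).card : ℝ) else 0) := by
      rw [Finset.sum_comm]
      refine Finset.sum_congr rfl fun f _ => ?_
      conv_lhs => rw [sq]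
      conv_lhs => enter [1]; rw [card_cutEdges_selected]
      rw [Finset.sum_mul]
      simp
    rw [this]
    refine (Finset.sum_le_sum fun e _ => sum_card_cutEdges_le {e} S).trans (le_of_eq ?_)
    simp only [Finset.card_singleton, Finset.sum_const, nsmul_eq_mul, m, c, fullCut]
    field_simp
    simp
  have h2 := sum_card_cutEdges (N := N) S
  have h3 : ∑ f : Finset V → Fin N, (((cutEdges (selected f) S).card : ℝ) - m) ^ 2 =
      ∑ f : Finset V → Fin N, ((cutEdges (selected f) S).card : ℝ) ^ 2 -
        2 * m * ∑ f : Finset V → Fin N, ((cutEdges (selected f) S).card : ℝ) + c * m ^ 2 := by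
    rw [Finset.mul_sum, ← Finset.sum_sub_distrib]
    have : c * m ^ 2 = ∑ _f : Finset V → Fin N, m ^ 2 := by
      rw [Finset.sum_const, nsmul_eq_mul, Finset.card_univ]
    rw [this, ← Finset.sum_add_distrib]
    exact Finset.sum_congr rfl fun f _ => by ring
  rw [h3, h2]
  change _ - 2 * m * (c * m) + _ ≤ c * m
  nlinarith

/-- Chebyshev's inequality for the number of selected edges in a cut. -/
lemma card_filter_deviation_le {N : ℕ} [NeZero N] {S : Finset V} (hS : 0 < fullCut S) :
    (((Finset.univ.filter fun f : Finset V → Fin N =>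
        (fullCut S : ℝ) / N / 2 < |((cutEdges (selected f) S).card : ℝ) - (fullCut S : ℝ) / N|).card
        : ℕ) : ℝ) ≤
      (Fintype.card (Finset V → Fin N) : ℝ) * (4 * N / fullCut S) := by
  have hN : (0 : ℝ) < N := Nat.cast_pos.2 (NeZero.pos N)
  have hd : (0 : ℝ) < fullCut S := Nat.cast_pos.2 hS
  have hv := sum_card_cutEdges_sub_sq_le (N := N) S
  set c : ℝ := (Fintype.card (Finset V → Fin N) : ℝ)
  set m : ℝ := (fullCut S : ℝ) / N with hm
  have hm0 : 0 < m := by positivity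
  set T := Finset.univ.filter fun f : Finset V → Fin N =>
    m / 2 < |((cutEdges (selected f) S).card : ℝ) - m|
  have h1 : (T.card : ℝ) * (m / 2) ^ 2 ≤
      ∑ f : Finset V → Fin N, (((cutEdges (selected f) S).card : ℝ) - m) ^ 2 := by
    rw [← nsmul_eq_mul, ← Finset.sum_const]
    refine (Finset.sum_le_sum fun f hf => ?_).trans
      (Finset.sum_le_sum_of_subset_of_nonneg (Finset.subset_univ T) fun _ _ _ => sq_nonneg _)
    rw [← sq_abs (_ - m)]
    exact pow_le_pow_left₀ (by positivity) (Finset.mem_filter.1 hf).2.le 2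
  have h2 : (T.card : ℝ) * (m / 2) ^ 2 ≤ c * m := h1.trans hv
  have h3 : (4 * N / fullCut S : ℝ) = m / (m / 2) ^ 2 := by
    rw [hm]; field_simp; norm_num
  rw [h3, ← mul_div_assoc, le_div_iff₀ (by positivity)]
  exact h2

lemma one_sub_sum_le_prod_inv (l : List ℝ) (hl : ∀ y ∈ l, 0 < y) :
    1 + l.length - l.sum ≤ (l.map fun y => y⁻¹).prod := by
  have h1 : 1 + l.length - l.sum ≤ 1 + (l.map fun y => Real.log y⁻¹).sum := by
    induction l with
    | nil => simp
    | cons y l ih =>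
      have hy : 0 < y := hl y (by simp)
      have := ih fun z hz => hl z (by simp [hz])
      have h := Real.log_le_sub_one_of_pos hy
      simp only [List.length_cons, List.sum_cons, List.map_cons, Real.log_inv] at *
      push_cast
      linarith
  have h2 : (l.map fun y => y⁻¹).prod = Real.exp (l.map fun y => Real.log y⁻¹).sum := by
    clear h1
    induction l with
    | nil => simp
    | cons y l ih =>
      have hy : 0 < y⁻¹ := inv_pos.2 (hl y (by simp))
      rw [List.map_cons, List.prod_cons, List.map_cons, List.sum_cons, Real.exp_add,
        Real.exp_log hy, ih fun z hz => hl z (by simp [hz])]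
  rw [h2]
  linarith [Real.add_one_le_exp (l.map fun y => Real.log y⁻¹).sum]

/-- The expectation of the product of the reciprocal sizes of the cuts in `L`, restricted to the
event that the edges in `F` are selected, is bounded below by Jensen's inequality. The factors `N`
gained from the sizes of the cuts compensate for the probability `N ^ (-F.card)` of the event. -/
lemma le_sum_prod_inv_card {N : ℕ} [NeZero N] {D : ℝ} (hD : 0 < D) (L : List (Finset V))
    (F : Finset (Finset V)) (hF : F.card ≤ L.length)
    (hLF : ∀ S ∈ L, (cutEdges F S).Nonempty) (hLD : ∀ S ∈ L, D ≤ fullCut S)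
    (hθ : 0 ≤ 1 - (L.length : ℝ) ^ 2 * N / D) :
    (Fintype.card (Finset V → Fin N) : ℝ) * (1 - (L.length : ℝ) ^ 2 * N / D) *
        (L.map fun S => (fullCut S : ℝ)⁻¹).prod ≤
      ∑ f : Finset V → Fin N, if F ⊆ selected f then
        (L.map fun S => ((cutEdges (selected f) S).card : ℝ)⁻¹).prod else 0 := by
  have hN : (0 : ℝ) < N := Nat.cast_pos.2 (NeZero.pos N)
  have hN1 : (1 : ℝ) ≤ N := Nat.one_le_cast.2 (NeZero.pos N)
  set c : ℝ := (Fintype.card (Finset V → Fin N) : ℝ)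
  have hc : 0 ≤ c := Nat.cast_nonneg _
  set P : ℝ := (L.map fun S => (fullCut S : ℝ)⁻¹).prod
  have hP : 0 ≤ P := List.prod_nonneg (by simp +contextual)
  set t : ℝ := (L.length : ℝ)
  have hd : ∀ S ∈ L, (0 : ℝ) < fullCut S := fun S hS => hD.trans_le (hLD S hS)
  have hsum : ∀ g : Finset V → ℝ, ∀ l : List (Finset V), ∀ f : Finset V → Fin N,
      (if F ⊆ selected f then (l.map g).sum else 0) =
        (l.map fun S => if F ⊆ selected f then g S else 0).sum := by
    intro g l f
    split_ifs <;> simp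
  -- The tangent line bound for the product, at the expected sizes of the cuts.
  have hpt : ∀ f : Finset V → Fin N, (N : ℝ) ^ L.length * P *
        ((1 + t) * (if F ⊆ selected f then 1 else 0) - (L.map fun S => N / (fullCut S : ℝ) *
          (if F ⊆ selected f then ((cutEdges (selected f) S).card : ℝ) else 0)).sum) ≤
      if F ⊆ selected f then
        (L.map fun S => ((cutEdges (selected f) S).card : ℝ)⁻¹).prod else 0 := by
    intro f
    by_cases h : F ⊆ selected f
    · simp only [h, if_true, mul_one]
      have hX : ∀ S ∈ L, (0 : ℝ) < (cutEdges (selected f) S).card := by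
        intro S hS
        obtain ⟨e, he⟩ := hLF S hS
        exact Nat.cast_pos.2 (Finset.card_pos.2
          ⟨e, mem_cutEdges.2 ⟨h (mem_cutEdges.1 he).1, (mem_cutEdges.1 he).2⟩⟩)
      have hle := one_sub_sum_le_prod_inv
        (L.map fun S => N / (fullCut S : ℝ) * ((cutEdges (selected f) S).card : ℝ)) (by
          intro y hy
          obtain ⟨S, hS, rfl⟩ := List.mem_map.1 hy
          have := hX S hS
          have := hd S hS
          positivity)
      rw [List.length_map, List.map_map] at hle
      refine (mul_le_mul_of_nonneg_left hle (by positivity)).trans (le_of_eq ?_)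
      have key : ∀ l : List (Finset V), (∀ S ∈ l, (0 : ℝ) < fullCut S) →
          (N : ℝ) ^ l.length * (l.map fun S => (fullCut S : ℝ)⁻¹).prod *
            (l.map ((fun y => y⁻¹) ∘ fun S => N / (fullCut S : ℝ) *
              ((cutEdges (selected f) S).card : ℝ))).prod =
          (l.map fun S => ((cutEdges (selected f) S).card : ℝ)⁻¹).prod := by
        intro l hl
        induction l with
        | nil => simp
        | cons S l ih =>
          have hS := hl S (by simp)
          have ih' := ih fun S hS => hl S (by simp [hS])
          simp only [List.map_cons, List.prod_cons, List.length_cons, ← ih', Function.comp,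
            mul_inv, inv_div, pow_succ]
          field_simp
      exact key L hd
    · simp only [h, if_false]
      have : (L.map fun S => N / (fullCut S : ℝ) * (0 : ℝ)).sum = 0 := by simp
      rw [this]; simp
  refine le_trans ?_ (Finset.sum_le_sum fun f _ => hpt f)
  rw [← Finset.mul_sum, Finset.sum_sub_distrib, ← Finset.mul_sum, sum_indicator_subset_selected]
  have hswap : ∀ l : List (Finset V), (∀ S ∈ l, D ≤ fullCut S) →
      ∑ f : Finset V → Fin N, (l.map fun S => N / (fullCut S : ℝ) *
          (if F ⊆ selected f then ((cutEdges (selected f) S).card : ℝ) else 0)).sum ≤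
        c / (N : ℝ) ^ F.card * (l.length * (1 + t * N / D)) := by
    intro l hl
    induction l with
    | nil => simp
    | cons S l ih =>
      have hS := hl S (by simp)
      have hS0 : (0 : ℝ) < fullCut S := hD.trans_le hS
      have ih' := ih fun S hS => hl S (by simp [hS])
      simp only [List.map_cons, List.sum_cons, List.length_cons, Finset.sum_add_distrib,
        ← Finset.mul_sum]
      have h1 := mul_le_mul_of_nonneg_left (sum_card_cutEdges_le (N := N) F S)
        (show 0 ≤ N / (fullCut S : ℝ) by positivity)
      have h2 : N / (fullCut S : ℝ) * (c / (N : ℝ) ^ F.card * ((fullCut S : ℝ) / N + F.card)) =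
          c / (N : ℝ) ^ F.card * (1 + F.card * N / fullCut S) := by
        field_simp
      have h3 : (F.card : ℝ) * N / fullCut S ≤ t * N / D := by
        have : (F.card : ℝ) ≤ t := Nat.cast_le.2 hF
        gcongr
      have h4 : c / (N : ℝ) ^ F.card * (1 + F.card * N / fullCut S) ≤
          c / (N : ℝ) ^ F.card * (1 + t * N / D) := by gcongr
      push_cast
      have h5 := (h1.trans (h2.le.trans h4))
      nlinarith [h5, ih']
  have h6 := hswap L hLD
  have h7 : c / (N : ℝ) ^ F.card * (1 - t ^ 2 * N / D) ≤
      (1 + t) * (c / (N : ℝ) ^ F.card) - ∑ f : Finset V → Fin N, (L.map fun S =>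
        N / (fullCut S : ℝ) *
          (if F ⊆ selected f then ((cutEdges (selected f) S).card : ℝ) else 0)).sum := by
    have : c / (N : ℝ) ^ F.card * (t * (1 + t * N / D)) =
        c / (N : ℝ) ^ F.card * (t + t ^ 2 * N / D) := by ring
    rw [this] at h6
    linarith
  refine le_trans ?_ (mul_le_mul_of_nonneg_left h7 (by positivity))
  have h8 : c ≤ (N : ℝ) ^ L.length * (c / (N : ℝ) ^ F.card) := by
    rw [← mul_div_assoc, le_div_iff₀ (by positivity), mul_comm]
    gcongr
  calc c * (1 - t ^ 2 * N / D) * P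
      ≤ ((N : ℝ) ^ L.length * (c / (N : ℝ) ^ F.card)) * (1 - t ^ 2 * N / D) * P := by gcongr
    _ = _ := by ring

end Counting

/-! ### Simulation on the complete hypergraph -/

section Simulation

variable {V : Type} [Fintype V] [DecidableEq V]

open EdgeQueryAlg

lemma cutEdges_mono {E E' : Finset (Finset V)} (h : E ⊆ E') (S : Finset V) :
    cutEdges E S ⊆ cutEdges E' S := Finset.filter_subset_filter _ h

lemma edgeOracle_of_not_nonempty {E : Finset (Finset V)} {S : Finset V}
    (h : ¬ (cutEdges E S).Nonempty) : edgeOracle E S = PMF.pure none := dif_neg h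

lemma run_query_toOuterMeasure {E : Finset (Finset V)} {S : Finset V}
    (h : (cutEdges E S).Nonempty) (next : Option (Finset V) → EdgeQueryAlg V)
    (B : Set (WHypergraph V)) :
    ((query S next).run E).toOuterMeasure B = ∑ e ∈ cutEdges E S,
      ((cutEdges E S).card : ℝ≥0∞)⁻¹ * ((next (some e)).run E).toOuterMeasure B := by
  rw [EdgeQueryAlg.run, edgeOracle, dif_pos h, PMF.bind_map, PMF.toOuterMeasure_bind_apply,
    tsum_eq_sum (s := cutEdges E S)]
  · refine Finset.sum_congr rfl fun e he => ?_
    rw [PMF.uniformOfFinset_apply_of_mem h he]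
    rfl
  · intro e he
    rw [PMF.uniformOfFinset_apply_of_notMem h he, zero_mul]

lemma le_run_query_toOuterMeasure (E : Finset (Finset V)) (S : Finset V)
    (next : Option (Finset V) → EdgeQueryAlg V) (B : Set (WHypergraph V)) :
    ∑ e ∈ cutEdges Finset.univ S, (if e ∈ E then
      ((cutEdges E S).card : ℝ≥0∞)⁻¹ * ((next (some e)).run E).toOuterMeasure B else 0) ≤
    ((query S next).run E).toOuterMeasure B := by
  have hE : (cutEdges Finset.univ S).filter (· ∈ E) = cutEdges E S := by
    ext e
    simp [cutEdges, and_comm]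
  rw [← Finset.sum_filter, hE]
  by_cases h : (cutEdges E S).Nonempty
  · rw [run_query_toOuterMeasure h]
  · rw [Finset.not_nonempty_iff_eq_empty.1 h]
    simp

/-- The weight of the labelling `f` after the queries in `L` have been answered by the edges in
`F`: the likelihood of these answers, as a function of `f`. -/
noncomputable def likelihood {N : ℕ} [NeZero N] (L : List (Finset V)) (F : Finset (Finset V))
    (f : Finset V → Fin N) : ℝ≥0∞ :=
  if F ⊆ selected f then
    (L.map fun S => ((cutEdges (selected f) S).card : ℝ≥0∞)⁻¹).prod else 0

lemma ofReal_prod_inv {ι : Type*} (l : List ι) (g : ι → ℕ) (hg : ∀ S ∈ l, 0 < g S) :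
    ENNReal.ofReal (l.map fun S => (g S : ℝ)⁻¹).prod =
      (l.map fun S => (g S : ℝ≥0∞)⁻¹).prod := by
  induction l with
  | nil => simp
  | cons S l ih =>
    have hS : (0 : ℝ) < g S := Nat.cast_pos.2 (hg S (by simp))
    rw [List.map_cons, List.prod_cons, List.map_cons, List.prod_cons,
      ENNReal.ofReal_mul (by positivity), ih fun S hS => hg S (by simp [hS]),
      ENNReal.ofReal_inv_of_pos hS, ENNReal.ofReal_natCast]

/-- The fraction of the success probability of a `t`-query algorithm on the complete hypergraph
that survives on a random subfamily of density `1 / N`. -/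
noncomputable def survival (N : ℕ) (D : ℝ) (t : ℕ) : ℝ := 1 - (t : ℝ) ^ 2 * N / D

lemma survival_anti {N : ℕ} {D : ℝ} (hD : 0 < D) {s t : ℕ} (h : s ≤ t) :
    survival N D t ≤ survival N D s := by
  unfold survival
  have : (s : ℝ) ≤ t := Nat.cast_le.2 h
  gcongr

lemma le_sum_likelihood {N : ℕ} [NeZero N] {D : ℝ} (hD : 0 < D) (L : List (Finset V))
    (F : Finset (Finset V)) (hF : F.card ≤ L.length)
    (hLF : ∀ S ∈ L, (cutEdges F S).Nonempty) (hLD : ∀ S ∈ L, D ≤ fullCut S) :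
    (Fintype.card (Finset V → Fin N) : ℝ≥0∞) * ENNReal.ofReal (survival N D L.length) *
        (L.map fun S => (fullCut S : ℝ≥0∞)⁻¹).prod ≤
      ∑ f : Finset V → Fin N, likelihood L F f := by
  rcases le_or_gt (survival N D L.length) 0 with hθ | hθ
  · simp [ENNReal.ofReal_of_nonpos hθ]
  have h := ENNReal.ofReal_le_ofReal (le_sum_prod_inv_card (N := N) hD L F hF hLF hLD hθ.le)
  change ENNReal.ofReal (_ * survival N D L.length * _) ≤ _ at h
  have hd : ∀ S ∈ L, 0 < fullCut S := fun S hS => Nat.cast_pos.1 (hD.trans_le (hLD S hS))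
  rw [ENNReal.ofReal_mul (mul_nonneg (Nat.cast_nonneg _) hθ.le),
    ENNReal.ofReal_mul (Nat.cast_nonneg _), ENNReal.ofReal_natCast, ofReal_prod_inv L _ hd] at h
  refine h.trans (le_of_eq ?_)
  have h0 : ∀ f : Finset V → Fin N,
      0 ≤ (L.map fun S => ((cutEdges (selected f) S).card : ℝ)⁻¹).prod :=
    fun f => List.prod_nonneg (by simp +contextual)
  rw [ENNReal.ofReal_sum_of_nonneg fun f _ => by split_ifs <;> simp [h0]]
  refine Finset.sum_congr rfl fun f _ => ?_
  unfold likelihood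
  split_ifs with hf
  · refine ofReal_prod_inv L _ fun S hS => ?_
    obtain ⟨e, he⟩ := hLF S hS
    exact Finset.card_pos.2 ⟨e, cutEdges_mono hf S he⟩
  · simp

/-- Simulation of the algorithm on the complete hypergraph. The list `L` and the set `F` record
the nontrivial queries made so far and the edges seen so far; the induction on the algorithm moves
each query from `A` to `L`. -/
lemma le_sum_likelihood_mul_run {N : ℕ} [NeZero N] {D : ℝ} (hD : 0 < D)
    (hmin : ∀ S : Finset V, (cutEdges Finset.univ S).Nonempty → D ≤ fullCut S)
    (B : Set (WHypergraph V)) (A : EdgeQueryAlg V) :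
    ∀ (q : ℕ) (L : List (Finset V)) (F : Finset (Finset V)), A.QueriesAtMost Finset.univ q →
      F.card ≤ L.length → (∀ S ∈ L, (cutEdges F S).Nonempty) →
      (Fintype.card (Finset V → Fin N) : ℝ≥0∞) *
          ENNReal.ofReal (survival N D (L.length + q)) *
          (L.map fun S => (fullCut S : ℝ≥0∞)⁻¹).prod *
          (A.run Finset.univ).toOuterMeasure B ≤
        ∑ f : Finset V → Fin N,
          likelihood L F f * (A.run (selected f)).toOuterMeasure B := by
  induction A with
  | output H' =>
    intro q L F _ hF hLF
    have hLD : ∀ S ∈ L, D ≤ fullCut S := fun S hS =>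
      hmin S ((hLF S hS).mono (cutEdges_mono (Finset.subset_univ _) S))
    simp only [EdgeQueryAlg.run]
    rw [← Finset.sum_mul]
    gcongr
    refine le_trans ?_ (le_sum_likelihood hD L F hF hLF hLD)
    gcongr
    exact survival_anti hD (Nat.le_add_right _ _)
  | random μ next ih =>
    intro q L F hq hF hLF
    simp only [EdgeQueryAlg.run, PMF.toOuterMeasure_bind_apply]
    simp_rw [← ENNReal.tsum_mul_left]
    rw [← Summable.tsum_finsetSum fun _ _ => ENNReal.summable]
    refine ENNReal.tsum_le_tsum fun r => ?_
    by_cases hr : r ∈ μ.support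
    · have := ih r q L F (hq r hr) hF hLF
      simp_rw [mul_left_comm _ (μ r), ← Finset.mul_sum]
      gcongr
    · rw [(PMF.apply_eq_zero_iff μ r).2 hr]
      simp
  | query S next ih =>
    intro q L F hq hF hLF
    cases q with
    | zero => exact hq.elim
    | succ q =>
      have hq' : ∀ a ∈ (edgeOracle Finset.univ S).support,
          QueriesAtMost Finset.univ (next a) q := hq
      by_cases hS : (cutEdges Finset.univ S).Nonempty
      · rw [run_query_toOuterMeasure hS]
        have hstep : ∀ e ∈ cutEdges Finset.univ S,
            (Fintype.card (Finset V → Fin N) : ℝ≥0∞) *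
              ENNReal.ofReal (survival N D (L.length + (q + 1))) *
              (L.map fun S => (fullCut S : ℝ≥0∞)⁻¹).prod *
              ((fullCut S : ℝ≥0∞)⁻¹ * ((next (some e)).run Finset.univ).toOuterMeasure B) ≤
            ∑ f : Finset V → Fin N, likelihood (S :: L) (insert e F) f *
              ((next (some e)).run (selected f)).toOuterMeasure B := by
          intro e he
          have hsupp : some e ∈ (edgeOracle Finset.univ S).support := by
            rw [edgeOracle, dif_pos hS, PMF.mem_support_map_iff]
            exact ⟨e, by rwa [PMF.mem_support_uniformOfFinset_iff], rfl⟩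
          have := ih (some e) q (S :: L) (insert e F) (hq' _ hsupp)
            ((Finset.card_insert_le _ _).trans (by simpa using hF)) (by
              intro T hT
              rcases List.mem_cons.1 hT with rfl | hT
              · exact ⟨e, mem_cutEdges.2 ⟨Finset.mem_insert_self _ _, (mem_cutEdges.1 he).2⟩⟩
              · exact (hLF T hT).mono (cutEdges_mono (Finset.subset_insert _ _) T))
          refine le_trans (le_of_eq ?_) this
          rw [List.map_cons, List.prod_cons, List.length_cons, add_assoc, add_comm 1 q]
          ring
        rw [Finset.mul_sum]
        refine (Finset.sum_le_sum hstep).trans ?_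
        rw [Finset.sum_comm]
        refine Finset.sum_le_sum fun f _ => ?_
        refine le_trans (le_of_eq ?_)
          (mul_le_mul_right (le_run_query_toOuterMeasure (selected f) S next B) _)
        rw [Finset.mul_sum]
        refine Finset.sum_congr rfl fun e _ => ?_
        unfold likelihood
        by_cases he : e ∈ selected f <;> by_cases hF : F ⊆ selected f <;>
          simp [he, hF, Finset.insert_subset_iff]
        ring
      · -- A trivial cut: every hypergraph answers `none`.
        have hS' : ∀ E : Finset (Finset V), edgeOracle E S = PMF.pure none := fun E =>
          edgeOracle_of_not_nonempty fun h => hS (h.mono (cutEdges_mono (Finset.subset_univ _) S))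
        have hrun : ∀ E : Finset (Finset V), (query S next).run E = (next none).run E := by
          intro E
          rw [EdgeQueryAlg.run, hS' E, PMF.pure_bind]
        simp only [hrun]
        refine le_trans ?_ (ih none q L F (hq' none (by simp [hS'])) hF hLF)
        gcongr
        exact survival_anti hD (by omega)

/-- On average over the random subfamily, an output event has at most the probability that it has
on the complete hypergraph, up to a small additive error: apply the simulation bound to its
complement. -/
lemma sum_run_toOuterMeasure_le {N : ℕ} [NeZero N] {D : ℝ} (hD : 0 < D)
    (hmin : ∀ S : Finset V, (cutEdges Finset.univ S).Nonempty → D ≤ fullCut S)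
    (B : Set (WHypergraph V)) {A : EdgeQueryAlg V} {q : ℕ}
    (hA : A.QueriesAtMost Finset.univ q) :
    ∑ f : Finset V → Fin N, (A.run (selected f)).toOuterMeasure B ≤
      (Fintype.card (Finset V → Fin N) : ℝ≥0∞) *
        ((A.run Finset.univ).toOuterMeasure B + ENNReal.ofReal ((q : ℝ) ^ 2 * N / D)) := by
  have hcompl : ∀ μ : PMF (WHypergraph V), μ.toOuterMeasure B + μ.toOuterMeasure Bᶜ = 1 := by
    intro μ
    rw [PMF.toOuterMeasure_apply, PMF.toOuterMeasure_apply, ← ENNReal.tsum_add, ← μ.tsum_coe]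
    exact tsum_congr fun x => by by_cases hx : x ∈ B <;> simp [hx]
  have h := le_sum_likelihood_mul_run (N := N) hD hmin Bᶜ A q [] ∅ hA (by simp) (by simp)
  simp only [likelihood, List.map_nil, List.prod_nil, List.length_nil, zero_add, mul_one,
    Finset.empty_subset, if_true, one_mul] at h
  set c : ℝ≥0∞ := (Fintype.card (Finset V → Fin N) : ℝ≥0∞) with hc
  set I := (A.run Finset.univ).toOuterMeasure B
  set J := (A.run Finset.univ).toOuterMeasure Bᶜ
  set s := ENNReal.ofReal (survival N D q)
  set r := ENNReal.ofReal ((q : ℝ) ^ 2 * N / D)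
  have hIJ : I + J = 1 := hcompl _
  have hJ1 : J ≤ 1 := hIJ ▸ le_add_self
  have hrs : 1 ≤ s + r := by
    rw [← ENNReal.ofReal_one]
    refine le_trans (ENNReal.ofReal_le_ofReal ?_) ENNReal.ofReal_add_le
    simp [survival]
  have htot : ∑ f : Finset V → Fin N, (A.run (selected f)).toOuterMeasure B +
      ∑ f : Finset V → Fin N, (A.run (selected f)).toOuterMeasure Bᶜ = c := by
    rw [← Finset.sum_add_distrib]
    simp [hcompl, hc]
  have hfin : ∑ f : Finset V → Fin N, (A.run (selected f)).toOuterMeasure Bᶜ ≠ ∞ := by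
    refine ne_top_of_le_ne_top (ENNReal.natCast_ne_top _) (le_add_self.trans htot.le)
  have hJ : J ≤ s * J + r := by
    calc J ≤ (s + r) * J := le_mul_of_one_le_left' hrs
      _ = s * J + r * J := add_mul _ _ _
      _ ≤ s * J + r * 1 := by gcongr
      _ = s * J + r := by rw [mul_one]
  refine (ENNReal.add_le_add_iff_right hfin).1 ?_
  calc _ = c * 1 := by rw [htot, mul_one]
    _ = c * (I + J) := by rw [hIJ]
    _ ≤ c * (I + (s * J + r)) := by gcongr
    _ = c * (I + r) + c * s * J := by ring
    _ ≤ _ := by gcongr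

end Simulation

/-! ### Disjoint windows and the lower bound -/

section LowerBound

variable {V : Type} [Fintype V] [DecidableEq V]

open EdgeQueryAlg

lemma unweighted_cutWeight (E : Finset (Finset V)) (S : Finset V) :
    (unweighted E).cutWeight S = (cutEdges E S).card := by
  simp [WHypergraph.cutWeight, unweighted]

/-- The outputs which can be `(1 ± ε)`-approximate sparsifiers of a hypergraph for which the size
of the cut `(S, Sᶜ)` is within a factor `1 ± 1/2` of `m`, as judged by this cut alone. -/
def weightWindow (ε : ℝ) (S : Finset V) (m : ℝ) : Set (WHypergraph V) :=
  {H' | (1 - ε) * (m / 2) ≤ H'.cutWeight S ∧ H'.cutWeight S ≤ (1 + ε) * (3 * m / 2)}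

lemma IsCutSparsifier.mem_weightWindow {ε m : ℝ} (hε0 : 0 < ε) (hε1 : ε < 1)
    {E : Finset (Finset V)} {S : Finset V} {H' : WHypergraph V}
    (h : IsCutSparsifier ε H' (unweighted E)) (hm : |((cutEdges E S).card : ℝ) - m| ≤ m / 2) :
    H' ∈ weightWindow ε S m := by
  have h' := abs_le.1 (h.2 S)
  rw [unweighted_cutWeight] at h'
  have hm' := abs_le.1 hm
  constructor <;> nlinarith

/-- The expected sizes `d / C ^ i` of the cut are so far apart that no output suits two of them. -/
lemma sum_weightWindow_le_one {ε : ℝ} (hε0 : 0 < ε) (hε1 : ε < 1) {C : ℝ}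
    (hC : 3 * (1 + ε) / (1 - ε) < C) (S : Finset V) {d : ℝ} (hd : 0 < d) (k : ℕ)
    (μ : PMF (WHypergraph V)) :
    ∑ i ∈ Finset.range k, μ.toOuterMeasure (weightWindow ε S (d / C ^ i)) ≤ 1 := by
  have hε : 0 < 1 - ε := by linarith
  have hC1 : 1 < C := by
    refine lt_trans ?_ hC
    rw [lt_div_iff₀ hε]
    linarith
  have hC0 : 0 < C := by linarith
  have hlt : ∀ i j : ℕ, i < j → ∀ H' ∈ weightWindow ε S (d / C ^ i),
      H' ∉ weightWindow ε S (d / C ^ j) := by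
    rintro i j hij H' ⟨hi, -⟩ ⟨-, hj⟩
    have h1 : d / C ^ j * C ≤ d / C ^ i := by
      rw [div_mul_eq_mul_div, div_le_div_iff₀ (by positivity) (by positivity), mul_assoc,
        ← pow_succ']
      gcongr
      · exact hC1.le
      · exact hij
    have h2 : 3 * (1 + ε) < C * (1 - ε) := (div_lt_iff₀ hε).1 hC
    have h3 : 0 < d / C ^ j := by positivity
    nlinarith [mul_le_mul_of_nonneg_left h1 hε.le, mul_lt_mul_of_pos_left h2 h3]
  have huniq : ∀ H' i j, H' ∈ weightWindow ε S (d / C ^ i) →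
      H' ∈ weightWindow ε S (d / C ^ j) → i = j := by
    intro H' i j hi hj
    rcases lt_trichotomy i j with h | h | h
    · exact absurd hj (hlt i j h H' hi)
    · exact h
    · exact absurd hi (hlt j i h H' hj)
  simp_rw [PMF.toOuterMeasure_apply]
  rw [← Summable.tsum_finsetSum fun _ _ => ENNReal.summable, ← μ.tsum_coe]
  refine ENNReal.tsum_le_tsum fun H' => ?_
  by_cases h : ∃ i ∈ Finset.range k, H' ∈ weightWindow ε S (d / C ^ i)
  · obtain ⟨i, hi, hH⟩ := h
    rw [Finset.sum_eq_single_of_mem i hi]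
    · simp [hH]
    · intro j _ hj
      exact Set.indicator_of_notMem (fun h => hj (huniq H' j i h hH)) _
  · push Not at h
    rw [Finset.sum_eq_zero fun i hi => Set.indicator_of_notMem (h i hi) _]
    exact zero_le

lemma exists_le_of_sum_le {ι : Type*} {s : Finset ι} (hs : s.Nonempty) {g h : ι → ℝ≥0∞}
    (hgh : ∑ i ∈ s, g i ≤ ∑ i ∈ s, h i) : ∃ i ∈ s, g i ≤ h i := by
  by_contra! hlt
  exact hgh.not_gt (ENNReal.sum_lt_sum_of_nonempty hs hlt)

/-- Some subfamily is bad for the algorithm: by Chebyshev's inequality, nearly all the random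
subfamilies require an output in one window, and on average the algorithm hits this window hardly
more often than on the complete hypergraph. -/
lemma exists_successProb_selected_le {ε : ℝ} (hε0 : 0 < ε) (hε1 : ε < 1) (N : ℕ) [NeZero N]
    {D : ℝ} (hD : 0 < D)
    (hmin : ∀ S : Finset V, (cutEdges Finset.univ S).Nonempty → D ≤ fullCut S)
    {S : Finset V} (hS : (cutEdges Finset.univ S).Nonempty) {A : EdgeQueryAlg V} {q : ℕ}
    (hA : A.QueriesAtMost Finset.univ q) :
    ∃ f : Finset V → Fin N, A.successProb ε (selected f) ≤
      (A.run Finset.univ).toOuterMeasure (weightWindow ε S ((fullCut S : ℝ) / N)) +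
        ENNReal.ofReal ((4 + (q : ℝ) ^ 2) * N / D) := by
  set B := weightWindow ε S ((fullCut S : ℝ) / N)
  set T := Finset.univ.filter fun f : Finset V → Fin N =>
    (fullCut S : ℝ) / N / 2 < |((cutEdges (selected f) S).card : ℝ) - (fullCut S : ℝ) / N| with hT
  have hpt : ∀ f : Finset V → Fin N, A.successProb ε (selected f) ≤
      (if f ∈ T then 1 else 0) + (A.run (selected f)).toOuterMeasure B := by
    intro f
    split_ifs with hf
    · refine le_trans ?_ le_self_add
      rw [successProb, PMF.toOuterMeasure_apply, ← (A.run (selected f)).tsum_coe]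
      exact ENNReal.tsum_le_tsum fun x => Set.indicator_le_self _ _ x
    · rw [zero_add, successProb]
      refine MeasureTheory.OuterMeasure.mono _ fun H' hH' => ?_
      refine IsCutSparsifier.mem_weightWindow hε0 hε1 hH' ?_
      simpa [hT] using hf
  have hcard : (T.card : ℝ≥0∞) ≤ (Fintype.card (Finset V → Fin N) : ℝ≥0∞) *
      ENNReal.ofReal (4 * N / D) := by
    have h := card_filter_deviation_le (N := N) (Finset.card_pos.2 hS)
    have h' : (T.card : ℝ) ≤ (Fintype.card (Finset V → Fin N) : ℝ) * (4 * N / D) := by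
      refine h.trans ?_
      have := hmin S hS
      gcongr
    have := ENNReal.ofReal_le_ofReal h'
    rwa [ENNReal.ofReal_mul (Nat.cast_nonneg _), ENNReal.ofReal_natCast,
      ENNReal.ofReal_natCast] at this
  have hsum : ∑ f : Finset V → Fin N, A.successProb ε (selected f) ≤
      ∑ _f : Finset V → Fin N, ((A.run Finset.univ).toOuterMeasure B +
        ENNReal.ofReal ((4 + (q : ℝ) ^ 2) * N / D)) := by
    refine (Finset.sum_le_sum fun f _ => hpt f).trans ?_
    rw [Finset.sum_add_distrib, Finset.sum_ite_mem, Finset.univ_inter, Finset.sum_const,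
      Finset.sum_const, Finset.card_univ, nsmul_eq_mul, nsmul_eq_mul, mul_one]
    refine (add_le_add hcard (sum_run_toOuterMeasure_le (N := N) hD hmin B hA)).trans
      (le_of_eq ?_)
    rw [add_mul, add_div, ENNReal.ofReal_add (by positivity) (by positivity)]
    ring
  obtain ⟨f, -, hf⟩ := exists_le_of_sum_le Finset.univ_nonempty hsum
  exact ⟨f, hf⟩

/-- Among the `k` densities `C ^ (-i)`, choose the one whose window the algorithm hits least often on
the complete hypergraph. -/
lemma exists_successProb_le {ε : ℝ} (hε0 : 0 < ε) (hε1 : ε < 1) {C : ℕ} (hC0 : 0 < C)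
    (hC : 3 * (1 + ε) / (1 - ε) < C) {D : ℝ} (hD : 0 < D)
    (hmin : ∀ S : Finset V, (cutEdges Finset.univ S).Nonempty → D ≤ fullCut S)
    {S : Finset V} (hS : (cutEdges Finset.univ S).Nonempty) {A : EdgeQueryAlg V} {q k : ℕ}
    (hk : 0 < k) (hA : A.QueriesAtMost Finset.univ q) :
    ∃ E : Finset (Finset V), A.successProb ε E ≤
      (k : ℝ≥0∞)⁻¹ + ENNReal.ofReal ((4 + (q : ℝ) ^ 2) * (C : ℝ) ^ k / D) := by
  have hd : (0 : ℝ) < fullCut S := hD.trans_le (hmin S hS)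
  have hk' : (k : ℝ≥0∞) ≠ 0 := Nat.cast_ne_zero.2 hk.ne'
  have hsum : ∑ i ∈ Finset.range k, (A.run Finset.univ).toOuterMeasure
      (weightWindow ε S ((fullCut S : ℝ) / (C : ℝ) ^ i)) ≤
      ∑ _i ∈ Finset.range k, (k : ℝ≥0∞)⁻¹ := by
    refine (sum_weightWindow_le_one hε0 hε1 hC S hd k _).trans (le_of_eq ?_)
    rw [Finset.sum_const, Finset.card_range, nsmul_eq_mul,
      ENNReal.mul_inv_cancel hk' (ENNReal.natCast_ne_top k)]
  obtain ⟨i, hi, hle⟩ := exists_le_of_sum_le (Finset.nonempty_range_iff.2 hk.ne') hsum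
  have : NeZero (C ^ i) := ⟨(pow_pos hC0 i).ne'⟩
  obtain ⟨f, hf⟩ := exists_successProb_selected_le hε0 hε1 (C ^ i) hD hmin hS hA
  refine ⟨selected f, hf.trans ?_⟩
  push_cast
  have hC1 : (1 : ℝ) ≤ C := Nat.one_le_cast.2 hC0
  refine add_le_add hle (ENNReal.ofReal_le_ofReal ?_)
  gcongr
  exact (Finset.mem_range.1 hi).le

lemma tendsto_natCast_eval_div_two_pow (P : Polynomial ℕ) :
    Tendsto (fun n : ℕ => ((P.eval n : ℕ) : ℝ) / 2 ^ n) atTop (𝓝 0) := by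
  have h : ∀ n : ℕ, ((P.eval n : ℕ) : ℝ) / 2 ^ n =
      ∑ i ∈ P.support, (P.coeff i : ℝ) * ((n : ℝ) ^ i / 2 ^ n) := by
    intro n
    rw [Polynomial.eval_eq_sum, Polynomial.sum, Nat.cast_sum, Finset.sum_div]
    refine Finset.sum_congr rfl fun i _ => ?_
    push_cast
    ring
  simp_rw [h]
  have : Tendsto (fun n : ℕ => ∑ i ∈ P.support, (P.coeff i : ℝ) * ((n : ℝ) ^ i / 2 ^ n)) atTop
      (𝓝 (∑ i ∈ P.support, (P.coeff i : ℝ) * 0)) :=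
    tendsto_finsetSum _ fun i _ =>
      (tendsto_pow_const_div_const_pow_of_one_lt i one_lt_two).const_mul _
  simpa using this

lemma tendsto_nat_log_atTop {C : ℕ} (hC : 1 < C) : Tendsto (fun n => Nat.log C n) atTop atTop :=
  tendsto_atTop.2 fun b =>
    (eventually_ge_atTop (C ^ b)).mono fun _ hn => Nat.le_log_of_pow_le hC hn

end LowerBound

/-- For every fixed `ε ∈ (0, 1)` and every polynomial `p` there is a bound `δ n = o(1)` such that
every randomized algorithm making at most `p n` cut edge queries on the hypergraphs with `n`
vertices (in particular every randomized algorithm with running time at most `p n`) has success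
probability at most `δ n` on some hypergraph with `n` vertices. -/
theorem theorem2 (ε : ℝ) (hε0 : 0 < ε) (hε1 : ε < 1) (p : Polynomial ℕ) :
    ∃ δ : ℕ → ℝ≥0∞, Tendsto δ atTop (𝓝 0) ∧
      ∀ (n : ℕ) (A : EdgeQueryAlg (Fin n)),
        (∀ E : Finset (Finset (Fin n)), A.QueriesAtMost E (p.eval n)) →
          ∃ E : Finset (Finset (Fin n)), A.successProb ε E ≤ δ n := by
  obtain ⟨C, hC⟩ := exists_nat_gt (3 * (1 + ε) / (1 - ε))
  have hC3 : (1 : ℝ) < C := by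
    refine lt_trans ?_ hC
    rw [lt_div_iff₀ (by linarith)]
    linarith
  have hC1 : 1 < C := by exact_mod_cast hC3
  -- The number of densities grows with `n`, but the smallest density is at least `1 / n`.
  refine ⟨fun n => (Nat.log C n : ℝ≥0∞)⁻¹ +
    ENNReal.ofReal ((4 + ((p.eval n : ℕ) : ℝ) ^ 2) * n / (2 ^ n / 4)), ?_, ?_⟩
  · have h1 : Tendsto (fun n : ℕ => (Nat.log C n : ℝ≥0∞)⁻¹) atTop (𝓝 0) :=
      ENNReal.tendsto_inv_nat_nhds_zero.comp (tendsto_nat_log_atTop hC1)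
    have h2 : Tendsto (fun n : ℕ => (4 + ((p.eval n : ℕ) : ℝ) ^ 2) * n / (2 ^ n / 4)) atTop (𝓝 0) := by
      refine (tendsto_natCast_eval_div_two_pow (4 * ((4 + p ^ 2) * Polynomial.X))).congr fun n => ?_
      simp only [Polynomial.eval_mul, Polynomial.eval_add, Polynomial.eval_pow, Polynomial.eval_X,
        Polynomial.eval_ofNat]
      push_cast
      field_simp
    have h3 := ENNReal.tendsto_ofReal h2
    rw [ENNReal.ofReal_zero] at h3
    simpa using h1.add h3
  · intro n A hA
    rcases Nat.eq_zero_or_pos (Nat.log C n) with hk | hk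
    · -- For `n < C` the bound is the value `0⁻¹ = ∞`.
      exact ⟨∅, by simp [hk]⟩
    · have hn : C ≤ n := (Nat.log_pos_iff.1 hk).1
      have hpow : (2 : ℝ) ^ (n - 2) = 2 ^ n / 4 := by
        rw [pow_sub₀ _ two_ne_zero (by omega)]
        norm_num
        ring
      have hmin : ∀ S : Finset (Fin n), (cutEdges Finset.univ S).Nonempty →
          (2 : ℝ) ^ n / 4 ≤ fullCut S := by
        intro S hS
        have := two_pow_le_fullCut hS
        rw [Fintype.card_fin] at this
        rw [← hpow]
        exact_mod_cast this
      have hS : (cutEdges Finset.univ {(⟨0, by omega⟩ : Fin n)}).Nonempty :=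
        ⟨Finset.univ, mem_cutEdges.2 ⟨Finset.mem_univ _, ⟨⟨0, by omega⟩, by simp⟩,
          ⟨⟨1, by omega⟩, by simp⟩⟩⟩
      obtain ⟨E, hE⟩ := exists_successProb_le hε0 hε1 (zero_lt_one.trans hC1) hC (by positivity)
        hmin hS hk (hA Finset.univ)
      refine ⟨E, hE.trans (add_le_add le_rfl (ENNReal.ofReal_le_ofReal ?_))⟩
      have hCn : (C : ℝ) ^ Nat.log C n ≤ n := by
        exact_mod_cast Nat.pow_log_le_self C (by omega)
      gcongr
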